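/- Let $(X,\mu)$ be a standard probability space, i.e. $X$ is a compact metrizable space and $\mu$ is a Borel probability measure on $X$. Let $m>1$ and $k\ge 1$ be integers, let $\alpha:\{1,\dots,m\}\to\{1,\dots,k\}$ be a (not necessarily surjective) map, and let $T_1,\dots,T_m$ be weakly mixing measure preserving transformations of $(X,\mu)$, i.e. each $T_j:X\to X$ is measurable and preserves $\mu$, and $T_j\times T_j$ is ergodic on $(X\times X,\mu\times\mu)$. Let $1\le p<\infty$ and let $E=L^p(X,\mu)$ (complex-valued functions). We also write $T_j$ for the induced isometry $g\mapsto g\circ T_j$ of $E$. Let $A_1,\dots,A_{m-1}$ be bounded linear operators on $E$, and suppose that the following two conditions hold. (A1) (Twisted compactness) For every $f\in E$, every $1\le j\le m-1$ and every $\varepsilon>0$ there is a direct sum decomposition $E=\mathcal U\oplus\mathcal R$ into linear subspaces (where $\mathcal R$ need not be closed) with $\dim\mathcal U<\infty$ such that, with $P_{\mathcal R}$ denoting the projection onto $\mathcal R$ along $\mathcal U$, one has $\|P_{\mathcal R}A_jT_j^nf\|_{L^\infty}<\varepsilon$ for all integers $n\ge 0$. (A2) (Joint $L^\infty$-boundedness)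 There is a constant $C>0$ such that for all integers $n\ge0$, all $1\le j\le m-1$ and all $g\in E\cap L^\infty(X,\mu)$ one has $A_jT_j^ng\in L^\infty(X,\mu)$ and $\|A_jT_j^ng\|_{L^\infty}\le C\|g\|_{L^\infty}$. Then for every $f\in E$ the entangled multi-Cesàro averages $$\frac1{N^k}\sum_{1\le n_1,\dots,n_k\le N}T_m^{n_{\alpha(m)}}A_{m-1}T_{m-1}^{n_{\alpha(m-1)}}\cdots A_2T_2^{n_{\alpha(2)}}A_1T_1^{n_{\alpha(1)}}f$$ converge $\mu$-almost everywhere, as $N\to\infty$, to the constant function $$\Bigl(\int_X f\,d\mu\Bigr)\prod_{i=1}^{m-1}\int_X A_i\mathbf 1\,d\mu ,$$ that is, to $\langle f,\mathbf 1\rangle\prod_{i=1}^{m-1}\langle A_i\mathbf 1,\mathbf 1\rangle$, where $\mathbf 1$ is the constant function $1$ and $\langle g,\mathbf 1\rangle=\int_X g\,d\mu$. -/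

import Mathlib

open MeasureTheory Filter Topology
open scoped ENNReal NNReal

/-- A self-map `T` of a probability space is a weakly mixing measure preserving transformation:
it preserves `μ`, and `T × T` is ergodic for `μ × μ`. -/
structure IsWeaklyMixing {X : Type*} [MeasurableSpace X] (T : X → X) (μ : Measure X) : Prop where
  measurePreserving : MeasurePreserving T μ μ
  ergodic_prod : Ergodic (Prod.map T T) (μ.prod μ)

/-- The Koopman operator `g ↦ g ∘ T` on complex `L^p`. -/
noncomputable def koopman {X : Type*} [MeasurableSpace X] {μ : Measure X} (p : ℝ≥0∞)
    [Fact (1 ≤ p)] {T : X → X} (hT : MeasurePreserving T μ μ) :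
    Lp ℂ p μ →L[ℂ] Lp ℂ p μ :=
  (Lp.compMeasurePreservingₗᵢ ℂ T hT).toContinuousLinearMap

/-- The entangled product of operators, with `m = d + 1` and indices shifted to start at `0`:
`S_d ^ e_d * A_{d-1} * S_{d-1} ^ e_{d-1} * ⋯ * A_0 * S_0 ^ e_0`. -/
noncomputable def entangledProduct {E : Type*} [NormedAddCommGroup E] [NormedSpace ℂ E] :
    (d : ℕ) → (Fin (d + 1) → E →L[ℂ] E) → (Fin d → E →L[ℂ] E) → (Fin (d + 1) → ℕ) → E →L[ℂ] E
  | 0, S, _, e => S 0 ^ e 0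
  | d + 1, S, A, e =>
      entangledProduct d (fun i => S i.succ) (fun i => A i.succ) (fun i => e i.succ) *
        A 0 * S 0 ^ e 0

/-- The value at `x` of the entangled multi-Cesàro average
`N^{-k} ∑_{1 ≤ n_1, …, n_k ≤ N} S_d ^ n_{α d} A_{d-1} ⋯ A_0 S_0 ^ n_{α 0} f`. -/
noncomputable def entangledAverage {X : Type*} [MeasurableSpace X] {μ : Measure X} {p : ℝ≥0∞}
    [Fact (1 ≤ p)] {d k : ℕ} (α : Fin (d + 1) → Fin k)
    (S : Fin (d + 1) → Lp ℂ p μ →L[ℂ] Lp ℂ p μ) (A : Fin d → Lp ℂ p μ →L[ℂ] Lp ℂ p μ)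
    (f : Lp ℂ p μ) (N : ℕ) (x : X) : ℂ :=
  (1 / (N : ℂ) ^ k) *
    ∑ n ∈ Fintype.piFinset (fun _ : Fin k => Finset.Icc 1 N),
      (entangledProduct d S A (fun i => n (α i)) f : X → ℂ) x

/-- Twisted compactness of the pair `(A, S)`: for all `f` and `ε > 0` there is a decomposition
`L^p = U ⊕ R` with `dim U < ∞` such that the projection onto `R` along `U` sends the orbit
`{A S^n f : n ∈ ℕ}` into the `ε`-ball of `L^∞`. -/
def TwistedCompact {X : Type*} [MeasurableSpace X] {μ : Measure X} {p : ℝ≥0∞}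
    [Fact (1 ≤ p)] (A S : Lp ℂ p μ →L[ℂ] Lp ℂ p μ) : Prop :=
  ∀ f : Lp ℂ p μ, ∀ ε : ℝ, 0 < ε →
    ∃ (U R : Submodule ℂ (Lp ℂ p μ)) (h : IsCompl R U), FiniteDimensional ℂ U ∧
      ∀ n : ℕ, eLpNorm (R.projection U h (A ((S ^ n) f)) : X → ℂ) ∞ μ < ENNReal.ofReal ε

/-- Joint `L^∞`-boundedness: all operators `A_j S_j^n` restrict to operators on `L^∞` with norm
bounded by a common constant. -/
def JointlyLinftyBounded {X : Type*} [MeasurableSpace X] {μ : Measure X} {p : ℝ≥0∞}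
    [Fact (1 ≤ p)] {ι : Type*} (A S : ι → Lp ℂ p μ →L[ℂ] Lp ℂ p μ) : Prop :=
  ∃ C : ℝ, 0 < C ∧ ∀ (n : ℕ) (j : ι) (g : Lp ℂ p μ), MemLp g ∞ μ →
    eLpNorm (A j ((S j ^ n) g) : X → ℂ) ∞ μ ≤ ENNReal.ofReal C * eLpNorm g ∞ μ

/-!
The operators are removed one at a time, from the right. Twisted compactness and weak mixing give,
for every `f` and `ε > 0`,
`A₀ S₀ⁿ f = (∫ f) A₀ 1 + ∑ᵢ cᵢ(n) gᵢ + rₙ`,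
with finitely many fixed functions `gᵢ`, bounded coefficients `cᵢ` for which the Cesàro means of
`|cᵢ|` tend to zero, and `‖rₙ‖_∞ ≤ ε` (`TwistedCompact.exists_decomposition`). By joint
`L^∞`-boundedness the remaining operators keep `rₙ` uniformly small, so its contribution to the
averages is `O(ε)` almost everywhere. The coefficients are absorbed in a weight on the box
`[1, N]^k`: the induction (`ae_tendsto_boxMean_entangledProduct`) treats bounded weights which tend
to a constant in mean, the terms with `cᵢ` have weights tending to zero in mean, and only
`(∫ f) A₀ 1` survives. In the base case only one Koopman operator is left, and Birkhoff's pointwise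
ergodic theorem, proved here for ergodic maps (`ae_tendsto_birkhoffSum_div`), gives the limit.

For the decomposition, let `f` have mean zero. Weak mixing implies that `φ (Sⁿ f) → 0` in the
absolute Cesàro sense for every functional `φ` on `L^p`. For bounded `f` this follows without any
description of the dual space: with unimodular `aₙ`, the mean of `|φ (Sⁿ f)|` is `φ` of the mean of
`aₙ Sⁿ f`, and by the Cauchy–Schwarz inequality the `L²` norm of the latter is controlled by the
ergodic averages of the tensor square of `f` under `T × T`
(`IsWeaklyMixing.cesaroNull_norm_apply`). Twisted compactness splits `A Sⁿ f = uₙ + rₙ` with `uₙ` in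
a finite-dimensional space `U` and `‖rₙ‖_∞ < ε`. The projections need not be continuous, so `uₙ`
itself need not tend to zero; but by Hahn–Banach separation and compactness its distance to the
part of `U` in the `L^∞` ball of radius `ε` does, in the Cesàro sense
(`exists_approx_of_cesaroNull_apply`). Moving a nearest point of that part to the remainder leaves a
term in `U` that tends to zero in norm in the Cesàro sense, and `cᵢ(n)` are its coordinates.
-/

/-! ### Cesàro means over intervals and boxes -/

/-- The Cesàro mean `N⁻¹ ∑_{1 ≤ n ≤ N} a n`. -/
noncomputable def cesaroMean {𝕜 : Type*} [Field 𝕜] (a : ℕ → 𝕜) (N : ℕ) : 𝕜 :=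
  (1 / (N : 𝕜)) * ∑ n ∈ Finset.Icc 1 N, a n

/-- The Cesàro mean `N^{-k} ∑_{1 ≤ n_1, …, n_k ≤ N} h n` over the box `[1, N]^k`. -/
noncomputable def boxMean {𝕜 : Type*} [Field 𝕜] {k : ℕ} (h : (Fin k → ℕ) → 𝕜) (N : ℕ) : 𝕜 :=
  (1 / (N : 𝕜) ^ k) * ∑ n ∈ Fintype.piFinset (fun _ : Fin k => Finset.Icc 1 N), h n

/-- A real sequence whose Cesàro means tend to zero. For bounded nonnegative sequences this means
convergence to zero along a set of density one. -/
def CesaroNull (a : ℕ → ℝ) : Prop :=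
  Tendsto (cesaroMean a) atTop (𝓝 0)

lemma cesaroMean_add {𝕜 : Type*} [Field 𝕜] (a b : ℕ → 𝕜) (N : ℕ) :
    cesaroMean (fun n => a n + b n) N = cesaroMean a N + cesaroMean b N := by
  simp only [cesaroMean, Finset.sum_add_distrib, mul_add]

lemma cesaroMean_mul_left {𝕜 : Type*} [Field 𝕜] (c : 𝕜) (a : ℕ → 𝕜) (N : ℕ) :
    cesaroMean (fun n => c * a n) N = c * cesaroMean a N := by
  simp only [cesaroMean, ← Finset.mul_sum]; ring

lemma cesaroMean_const_le {c : ℝ} (hc : 0 ≤ c) (N : ℕ) : cesaroMean (fun _ => c) N ≤ c := by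
  rcases Nat.eq_zero_or_pos N with rfl | hN
  · simpa [cesaroMean]
  · have : (N : ℝ) ≠ 0 := by positivity
    simp [cesaroMean, this]

lemma cesaroMean_mono {a b : ℕ → ℝ} (h : ∀ n, a n ≤ b n) (N : ℕ) :
    cesaroMean a N ≤ cesaroMean b N := by
  unfold cesaroMean
  gcongr
  exact h _

lemma cesaroMean_nonneg {a : ℕ → ℝ} (h : ∀ n, 0 ≤ a n) (N : ℕ) : 0 ≤ cesaroMean a N :=
  mul_nonneg (by positivity) (Finset.sum_nonneg fun _ _ => h _)

namespace CesaroNull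

lemma zero : CesaroNull (fun _ => 0) := by
  have : cesaroMean (fun _ => 0) = fun _ => (0 : ℝ) := by ext; simp [cesaroMean]
  rw [CesaroNull, this]
  exact tendsto_const_nhds

lemma add {a b : ℕ → ℝ} (ha : CesaroNull a) (hb : CesaroNull b) :
    CesaroNull (fun n => a n + b n) := by
  have := Tendsto.add ha hb
  rw [add_zero] at this
  exact this.congr fun N => (cesaroMean_add a b N).symm

lemma const_mul {a : ℕ → ℝ} (c : ℝ) (ha : CesaroNull a) : CesaroNull (fun n => c * a n) := by
  have := Tendsto.const_mul c ha
  rw [mul_zero] at this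
  exact this.congr fun N => (cesaroMean_mul_left c a N).symm

/-- A nonnegative sequence is Cesàro null as soon as it is dominated, up to every `τ > 0`, by a
Cesàro null sequence. -/
lemma of_forall_le_add {a : ℕ → ℝ} (ha : ∀ n, 0 ≤ a n)
    (h : ∀ τ : ℝ, 0 < τ → ∃ b, CesaroNull b ∧ ∀ n, a n ≤ τ + b n) : CesaroNull a := by
  rw [CesaroNull, Metric.tendsto_atTop]
  intro δ hδ
  obtain ⟨b, hb, hab⟩ := h (δ / 2) (by positivity)
  obtain ⟨N₀, hN₀⟩ := Metric.tendsto_atTop.1 hb (δ / 2) (by positivity)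
  refine ⟨N₀, fun N hN => ?_⟩
  have h1 := hN₀ N hN
  have h2 := cesaroMean_mono hab N
  rw [cesaroMean_add] at h2
  have h3 := cesaroMean_const_le (c := δ / 2) (by positivity) N
  have h4 := cesaroMean_nonneg ha N
  rw [Real.dist_eq, sub_zero] at *
  rw [abs_of_nonneg h4]
  linarith [le_abs_self (cesaroMean b N)]

lemma mono {a b : ℕ → ℝ} (ha : ∀ n, 0 ≤ a n) (hab : ∀ n, a n ≤ b n) (hb : CesaroNull b) :
    CesaroNull a :=
  of_forall_le_add ha fun τ hτ => ⟨b, hb, fun n => by linarith [hab n]⟩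

end CesaroNull

section boxMean

variable {k : ℕ}

lemma boxMean_add {𝕜 : Type*} [Field 𝕜] (g h : (Fin k → ℕ) → 𝕜) (N : ℕ) :
    boxMean (fun n => g n + h n) N = boxMean g N + boxMean h N := by
  simp only [boxMean, Finset.sum_add_distrib, mul_add]

lemma boxMean_sum {𝕜 ι : Type*} [Field 𝕜] (s : Finset ι) (h : ι → (Fin k → ℕ) → 𝕜) (N : ℕ) :
    boxMean (fun n => ∑ i ∈ s, h i n) N = ∑ i ∈ s, boxMean (h i) N := by
  simp only [boxMean]
  rw [Finset.sum_comm, Finset.mul_sum]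

lemma boxMean_mul_left {𝕜 : Type*} [Field 𝕜] (c : 𝕜) (h : (Fin k → ℕ) → 𝕜) (N : ℕ) :
    boxMean (fun n => c * h n) N = c * boxMean h N := by
  simp only [boxMean, ← Finset.mul_sum]; ring

lemma boxMean_mono {g h : (Fin k → ℕ) → ℝ} (hgh : ∀ n, g n ≤ h n) (N : ℕ) :
    boxMean g N ≤ boxMean h N := by
  unfold boxMean
  gcongr
  exact hgh _

lemma boxMean_nonneg {h : (Fin k → ℕ) → ℝ} (hh : ∀ n, 0 ≤ h n) (N : ℕ) : 0 ≤ boxMean h N :=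
  mul_nonneg (by positivity) (Finset.sum_nonneg fun _ _ => hh _)

lemma norm_boxMean_le (h : (Fin k → ℕ) → ℂ) (N : ℕ) :
    ‖boxMean h N‖ ≤ boxMean (fun n => ‖h n‖) N := by
  unfold boxMean
  rw [norm_mul]
  gcongr
  · simp
  · exact norm_sum_le _ _

lemma boxMean_const {𝕜 : Type*} [Field 𝕜] [CharZero 𝕜] (c : 𝕜) {N : ℕ} (hN : N ≠ 0) :
    boxMean (fun _ : Fin k → ℕ => c) N = c := by
  have : (N : 𝕜) ≠ 0 := by exact_mod_cast hN
  simp [boxMean, Fintype.card_piFinset, this]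

/-- The box mean of a function of a single coordinate is a Cesàro mean. -/
lemma boxMean_coord {𝕜 : Type*} [Field 𝕜] [CharZero 𝕜] (a : Fin k) (h : ℕ → 𝕜) {N : ℕ}
    (hN : N ≠ 0) :
    boxMean (fun n : Fin k → ℕ => h (n a)) N = cesaroMean h N := by
  have hN' : (N : 𝕜) ≠ 0 := by exact_mod_cast hN
  have key := Finset.prod_univ_sum (fun _ : Fin k => Finset.Icc 1 N)
    (fun i j => if i = a then h j else 1)
  have e1 : ∀ n : Fin k → ℕ, ∏ i, (if i = a then h (n i) else 1) = h (n a) := fun n => by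
    simp
  have e2 : ∏ i : Fin k, ∑ j ∈ Finset.Icc 1 N, (if i = a then h j else 1)
      = (∑ j ∈ Finset.Icc 1 N, h j) * (N : 𝕜) ^ (k - 1) := by
    rw [← Finset.mul_prod_erase _ _ (Finset.mem_univ a)]
    congr 1
    · simp
    · rw [Finset.prod_congr rfl (g := fun _ => (N : 𝕜))]
      · simp
      · intro i hi
        simp [Finset.ne_of_mem_erase hi]
  simp only [e1] at key
  rw [e2] at key
  have hk : (N : 𝕜) ^ k = (N : 𝕜) ^ (k - 1) * N := by
    rw [← pow_succ, Nat.sub_add_cancel (Nat.one_le_of_lt a.pos)]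
  rw [boxMean, cesaroMean, ← key, hk]
  field_simp

end boxMean

/-! ### The pointwise ergodic theorem for ergodic maps -/

/-- The maximum of the Birkhoff sums of `f` along `T` of length at most `n`, the empty sum
included. -/
def maxBirkhoffSum {X : Type*} (T : X → X) (f : X → ℝ) : ℕ → X → ℝ
  | 0, _ => 0
  | n + 1, x => max 0 (f x + maxBirkhoffSum T f n (T x))

section Birkhoff

variable {X : Type*} {T : X → X} {f : X → ℝ}

lemma maxBirkhoffSum_nonneg (n : ℕ) (x : X) : 0 ≤ maxBirkhoffSum T f n x := by
  cases n with
  | zero => simp [maxBirkhoffSum]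
  | succ n => exact le_max_left _ _

lemma maxBirkhoffSum_le_succ (n : ℕ) (x : X) :
    maxBirkhoffSum T f n x ≤ maxBirkhoffSum T f (n + 1) x := by
  induction n generalizing x with
  | zero => exact maxBirkhoffSum_nonneg _ _
  | succ n ih => exact max_le_max le_rfl (by gcongr; exact ih (T x))

lemma maxBirkhoffSum_monotone (x : X) : Monotone fun n => maxBirkhoffSum T f n x :=
  monotone_nat_of_le_succ fun n => maxBirkhoffSum_le_succ n x

lemma birkhoffSum_le_maxBirkhoffSum (n : ℕ) (x : X) :
    birkhoffSum T f n x ≤ maxBirkhoffSum T f n x := by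
  induction n generalizing x with
  | zero => simp [maxBirkhoffSum]
  | succ n ih =>
    rw [birkhoffSum_succ']
    exact le_max_of_le_right (by gcongr; exact ih (T x))

variable [MeasurableSpace X] {μ : Measure X}

lemma measurable_maxBirkhoffSum (hT : Measurable T) (hf : Measurable f) (n : ℕ) :
    Measurable (maxBirkhoffSum T f n) := by
  induction n with
  | zero => exact measurable_const
  | succ n ih => exact measurable_const.max (hf.add (ih.comp hT))

lemma integrable_maxBirkhoffSum (hT : MeasurePreserving T μ μ) (hf : Integrable f μ) (n : ℕ) :
    Integrable (maxBirkhoffSum T f n) μ := by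
  induction n with
  | zero => exact integrable_zero _ _ _
  | succ n ih => exact (integrable_zero _ _ _).sup (hf.add (hT.integrable_comp_of_integrable ih))

/-- If the Birkhoff sums of `f` are unbounded above almost everywhere, then `∫ f ≥ 0`: the
functions `G (n + 1) - G n ∘ T`, where `G` is the maximal Birkhoff sum, have nonnegative integral
and converge to `f`, dominated by `|f|`. -/
lemma integral_nonneg_of_ae_maxBirkhoffSum_unbounded (hT : MeasurePreserving T μ μ)
    (hf : Integrable f μ) (h : ∀ᵐ x ∂μ, ∀ M : ℝ, ∃ n, M < maxBirkhoffSum T f n x) :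
    0 ≤ ∫ x, f x ∂μ := by
  set G := maxBirkhoffSum T f with hG
  have hGi := fun n => integrable_maxBirkhoffSum hT hf n
  have hGT : ∀ n, Integrable (fun x => G n (T x)) μ := fun n =>
    hT.integrable_comp_of_integrable (hGi n)
  have key : ∀ n x, G (n + 1) x - G n (T x) = max (-G n (T x)) (f x) := fun n x => by
    rw [hG, maxBirkhoffSum, max_sub_sub_right _ _ _ |>.symm]
    simp
  have hlim : Tendsto (fun n => ∫ x, (G (n + 1) x - G n (T x)) ∂μ) atTop (𝓝 (∫ x, f x ∂μ)) := by
    refine tendsto_integral_of_dominated_convergence (fun x => |f x|) (fun n => ?_) hf.abs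
      (fun n => Eventually.of_forall fun x => ?_) ?_
    · exact ((hGi _).sub (hGT n)).aestronglyMeasurable
    · rw [key, Real.norm_eq_abs]
      have := maxBirkhoffSum_nonneg (T := T) (f := f) n (T x)
      refine abs_le.2 ⟨(neg_abs_le _).trans (le_max_right _ _), max_le ?_ (le_abs_self _)⟩
      linarith [abs_nonneg (f x)]
    · filter_upwards [hT.quasiMeasurePreserving.ae h] with x hx
      obtain ⟨n₀, hn₀⟩ := hx (-f x)
      refine tendsto_const_nhds.congr' ?_
      filter_upwards [eventually_ge_atTop n₀] with n hn
      rw [key, max_eq_right]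
      have := maxBirkhoffSum_monotone (T := T) (f := f) (T x) hn
      simp only at this
      linarith
  refine ge_of_tendsto' hlim fun n => ?_
  rw [integral_sub (hGi _) (hGT n)]
  have h1 : ∫ x, G n (T x) ∂μ = ∫ x, G n x ∂μ := by
    have := integral_map (μ := μ) hT.measurable.aemeasurable (f := G n)
      (by rw [hT.map_eq]; exact (hGi n).aestronglyMeasurable)
    rw [← this, hT.map_eq]
  rw [h1, sub_nonneg]
  exact integral_mono (hGi n) (hGi _) fun x => maxBirkhoffSum_le_succ n x

/-- The set of points at which the maximal Birkhoff sums are unbounded is invariant, hence null or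
conull; if `∫ f < 0`, it is not conull. -/
lemma ae_birkhoffSum_bddAbove_of_integral_neg [IsProbabilityMeasure μ] (hT : Ergodic T μ)
    (hfm : Measurable f) (hf : Integrable f μ) (hneg : ∫ x, f x ∂μ < 0) :
    ∀ᵐ x ∂μ, ∃ M : ℝ, ∀ n, birkhoffSum T f n x ≤ M := by
  set B : Set X := {x | ∀ M : ℝ, ∃ n, M < maxBirkhoffSum T f n x} with hB
  have hBm : MeasurableSet B := by
    have : B = ⋂ M : ℕ, ⋃ n : ℕ, {x | (M : ℝ) < maxBirkhoffSum T f n x} := by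
      ext x
      simp only [hB, Set.mem_ofPred_eq, Set.mem_iInter, Set.mem_iUnion]
      refine ⟨fun h M => h M, fun h M => ?_⟩
      obtain ⟨m, hm⟩ := exists_nat_gt M
      obtain ⟨n, hn⟩ := h m
      exact ⟨n, hm.trans hn⟩
    rw [this]
    exact MeasurableSet.iInter fun M => MeasurableSet.iUnion fun n =>
      measurableSet_lt measurable_const (measurable_maxBirkhoffSum hT.measurable hfm n)
  have hBinv : T ⁻¹' B = B := by
    ext x
    simp only [hB, Set.mem_preimage, Set.mem_ofPred_eq]
    constructor
    · intro h M
      obtain ⟨n, hn⟩ := h (M - f x)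
      exact ⟨n + 1, lt_max_of_lt_right (by linarith)⟩
    · intro h M
      obtain ⟨n, hn⟩ := h (max 0 (f x + M))
      cases n with
      | zero => exact absurd hn (not_lt.2 (le_max_left _ _))
      | succ n =>
        refine ⟨n, ?_⟩
        by_contra! hcon
        refine absurd hn (not_lt.2 (max_le_max le_rfl ?_))
        gcongr
  rcases hT.toPreErgodic.ae_mem_or_ae_notMem hBm hBinv with h | h
  · exact absurd (integral_nonneg_of_ae_maxBirkhoffSum_unbounded hT.toMeasurePreserving hf h)
      (not_le.2 hneg)
  · filter_upwards [h] with x hx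
    simp only [hB, Set.mem_ofPred_eq, not_forall, not_exists, not_lt] at hx
    obtain ⟨M, hM⟩ := hx
    exact ⟨M, fun n => (birkhoffSum_le_maxBirkhoffSum n x).trans (hM n)⟩

/-- The upper half of the pointwise ergodic theorem: for `ε > 0` the Birkhoff sums of
`f - ∫ f - ε` are bounded above almost everywhere. -/
lemma ae_eventually_birkhoffAverage_le [IsProbabilityMeasure μ] (hT : Ergodic T μ)
    (hfm : Measurable f) (hf : Integrable f μ) :
    ∀ᵐ x ∂μ, ∀ ε : ℝ, 0 < ε →
      ∀ᶠ n : ℕ in atTop, (1 / (n : ℝ)) * birkhoffSum T f n x ≤ ∫ y, f y ∂μ + ε := by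
  have h : ∀ l : ℕ, ∀ᵐ x ∂μ, ∃ M : ℝ, ∀ n,
      birkhoffSum T (fun y => f y - (∫ y, f y ∂μ + 1 / (l + 1 : ℝ))) n x ≤ M := fun l => by
    refine ae_birkhoffSum_bddAbove_of_integral_neg hT (hfm.sub_const _)
      (hf.sub (integrable_const _)) ?_
    rw [integral_sub hf (integrable_const _)]
    simp only [integral_const, probReal_univ, one_smul]
    have : 0 < 1 / (l + 1 : ℝ) := by positivity
    linarith
  filter_upwards [ae_all_iff.2 h] with x hx ε hε
  obtain ⟨l, hl⟩ := exists_nat_one_div_lt (half_pos hε)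
  obtain ⟨M, hM⟩ := hx l
  obtain ⟨n₀, hn₀⟩ := exists_nat_gt (M / (ε / 2))
  filter_upwards [eventually_ge_atTop (n₀ + 1)] with n hn
  have hn' : (0 : ℝ) < n := by exact_mod_cast (Nat.succ_pos _).trans_le hn
  have h1 := hM n
  have h2 : birkhoffSum T (fun y => f y - (∫ y, f y ∂μ + 1 / (l + 1 : ℝ))) n x
      = birkhoffSum T f n x - n * (∫ y, f y ∂μ + 1 / (l + 1 : ℝ)) := by
    simp only [birkhoffSum, Finset.sum_sub_distrib, Finset.sum_const, Finset.card_range,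
      nsmul_eq_mul]
  rw [h2] at h1
  have h3 : M ≤ n * (ε / 2) := by
    rw [div_lt_iff₀ (by positivity)] at hn₀
    refine hn₀.le.trans ?_
    gcongr
    exact (Nat.le_succ _).trans hn
  rw [one_div, inv_mul_le_iff₀ hn']
  have h4 : (n : ℝ) * (1 / (l + 1 : ℝ)) ≤ n * (ε / 2) := by gcongr
  nlinarith

/-- Birkhoff's pointwise ergodic theorem for an ergodic map of a probability space. -/
theorem ae_tendsto_birkhoffSum_div [IsProbabilityMeasure μ] (hT : Ergodic T μ)
    (hfm : Measurable f) (hf : Integrable f μ) :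
    ∀ᵐ x ∂μ, Tendsto (fun n : ℕ => (1 / (n : ℝ)) * birkhoffSum T f n x) atTop
      (𝓝 (∫ y, f y ∂μ)) := by
  filter_upwards [ae_eventually_birkhoffAverage_le hT hfm hf,
    ae_eventually_birkhoffAverage_le hT hfm.neg hf.neg] with x h1 h2
  rw [Metric.tendsto_nhds]
  intro ε hε
  filter_upwards [h1 (ε / 2) (by positivity), h2 (ε / 2) (by positivity)] with n hn1 hn2
  have h3 : birkhoffSum T (-f) n x = -birkhoffSum T f n x := by simp [birkhoffSum]
  simp only [h3, Pi.neg_apply, integral_neg] at hn2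
  rw [Real.dist_eq, abs_lt]
  constructor <;> linarith

lemma ae_tendsto_cesaroMean_comp_iterate_real [IsProbabilityMeasure μ] (hT : Ergodic T μ)
    (hfm : Measurable f) (hf : Integrable f μ) :
    ∀ᵐ x ∂μ, Tendsto (cesaroMean fun n => f (T^[n] x)) atTop (𝓝 (∫ y, f y ∂μ)) := by
  filter_upwards [hT.quasiMeasurePreserving.ae (ae_tendsto_birkhoffSum_div hT hfm hf)] with x hx
  refine hx.congr fun N => ?_
  rw [cesaroMean, birkhoffSum, Finset.range_eq_Ico, ← Finset.Ico_add_one_right_eq_Icc,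
    ← Finset.sum_Ico_add' _ 0 N 1]
  simp [Function.iterate_succ_apply]

/-- Birkhoff's pointwise ergodic theorem for complex functions, with orbits starting at `T x`. -/
theorem ae_tendsto_cesaroMean_comp_iterate [IsProbabilityMeasure μ] (hT : Ergodic T μ) {g : X → ℂ}
    (hgm : Measurable g) (hg : Integrable g μ) :
    ∀ᵐ x ∂μ, Tendsto (cesaroMean fun n => g (T^[n] x)) atTop (𝓝 (∫ y, g y ∂μ)) := by
  filter_upwards [
    ae_tendsto_cesaroMean_comp_iterate_real hT (Complex.measurable_re.comp hgm) hg.re,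
    ae_tendsto_cesaroMean_comp_iterate_real hT (Complex.measurable_im.comp hgm) hg.im] with x h1 h2
  have h3 := ((Complex.continuous_ofReal.tendsto _).comp h1).add
    (((Complex.continuous_ofReal.tendsto _).comp h2).mul_const Complex.I)
  have h4 : ((∫ y, (g y).re ∂μ : ℝ) : ℂ) + ((∫ y, (g y).im ∂μ : ℝ) : ℂ) * Complex.I
      = ∫ y, g y ∂μ := integral_re_add_im hg
  rw [← h4]
  refine h3.congr fun N => ?_
  simp only [Function.comp_apply, cesaroMean, Complex.ofReal_mul, Complex.ofReal_sum,
    Complex.ofReal_div, Complex.ofReal_one, Complex.ofReal_natCast]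
  rw [mul_assoc, ← mul_add, Finset.sum_mul, ← Finset.sum_add_distrib]
  simp only [Complex.re_add_im]

end Birkhoff

/-! ### Weakly mixing maps -/

section WeakMixing

variable {X : Type*} [MeasurableSpace X] {μ : Measure X}

lemma IsWeaklyMixing.ergodic [IsProbabilityMeasure μ] {T : X → X} (hT : IsWeaklyMixing T μ) :
    Ergodic T μ :=
  measurePreserving_fst.ergodic_of_ergodic_semiconj hT.ergodic_prod
    hT.measurePreserving.measurable fun _ => rfl

lemma coeFn_koopman_pow {p : ℝ≥0∞} [Fact (1 ≤ p)] {T : X → X} (hT : MeasurePreserving T μ μ)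
    (n : ℕ) (g : Lp ℂ p μ) : ((koopman p hT ^ n) g : X → ℂ) =ᵐ[μ] g ∘ T^[n] := by
  induction n with
  | zero => rfl
  | succ n ih =>
    have h1 : ((koopman p hT ^ (n + 1)) g : X → ℂ) =ᵐ[μ] ((koopman p hT ^ n) g : X → ℂ) ∘ T := by
      rw [pow_succ']
      exact Lp.coeFn_compMeasurePreserving ((koopman p hT ^ n) g) hT
    exact h1.trans (hT.quasiMeasurePreserving.ae_eq_comp ih)

lemma norm_koopman_pow_le {p : ℝ≥0∞} [Fact (1 ≤ p)] {T : X → X}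
    (hT : MeasurePreserving T μ μ) (n : ℕ) (g : Lp ℂ p μ) :
    ‖(koopman p hT ^ n) g‖ ≤ ‖g‖ := by
  induction n with
  | zero => exact le_rfl
  | succ n ih =>
    rw [pow_succ']
    exact (Lp.norm_compMeasurePreserving ((koopman p hT ^ n) g) hT).le.trans ih

/-- A sum of bounded functions with coefficients in the unit disc is controlled in `L²(μ)`,
uniformly in the coefficients, by the sum of the tensor squares in `L²(μ × μ)`: both sides are
expressed through the correlations `∫ u n * conj (u m)`, and the Cauchy–Schwarz inequality applies
to the double sum. -/
lemma sq_integral_norm_sum_mul_sq_le [IsFiniteMeasure μ] {ι : Type*} (s : Finset ι)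
    {u : ι → X → ℂ} (hu : ∀ i, Measurable (u i)) {B : ℝ} (hB : ∀ i x, ‖u i x‖ ≤ B)
    {a : ι → ℂ} (ha : ∀ i, ‖a i‖ ≤ 1) :
    (∫ x, ‖∑ i ∈ s, a i * u i x‖ ^ 2 ∂μ) ^ 2 ≤
      (s.card : ℝ) ^ 2 *
        ∫ z, ‖∑ i ∈ s, u i z.1 * (starRingEnd ℂ) (u i z.2)‖ ^ 2 ∂(μ.prod μ) := by
  set c : ι → ι → ℂ := fun i j => ∫ x, u i x * (starRingEnd ℂ) (u j x) ∂μ with hc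
  have hconj : ∀ i, Measurable fun x => (starRingEnd ℂ) (u i x) := fun i =>
    Complex.continuous_conj.measurable.comp (hu i)
  have hprod : ∀ i j x, ‖u i x * (starRingEnd ℂ) (u j x)‖ ≤ B * B := fun i j x => by
    rw [norm_mul, RCLike.norm_conj]
    exact mul_le_mul (hB i x) (hB j x) (norm_nonneg _) ((norm_nonneg _).trans (hB i x))
  have hint : ∀ i j, Integrable (fun x => u i x * (starRingEnd ℂ) (u j x)) μ := fun i j =>
    Integrable.of_bound ((hu i).mul (hconj j)).aestronglyMeasurable (B * B)
      (Eventually.of_forall (hprod i j))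
  have hsq : ∀ v : ι → ℂ, ((‖∑ i ∈ s, v i‖ ^ 2 : ℝ) : ℂ)
      = ∑ i ∈ s, ∑ j ∈ s, v i * (starRingEnd ℂ) (v j) := fun v => by
    rw [Complex.ofReal_pow, ← Complex.mul_conj', map_sum, Finset.sum_mul_sum]
  have h1 : ((∫ x, ‖∑ i ∈ s, a i * u i x‖ ^ 2 ∂μ : ℝ) : ℂ)
      = ∑ i ∈ s, ∑ j ∈ s, a i * (starRingEnd ℂ) (a j) * c i j := by
    rw [← integral_complex_ofReal]
    simp only [hsq]
    rw [integral_finsetSum]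
    · refine Finset.sum_congr rfl fun i _ => ?_
      rw [integral_finsetSum]
      · refine Finset.sum_congr rfl fun j _ => ?_
        rw [hc, ← integral_const_mul]
        refine integral_congr_ae (Eventually.of_forall fun x => ?_)
        simp only [map_mul]; ring
      · intro j _
        refine ((hint i j).const_mul (a i * (starRingEnd ℂ) (a j))).congr
          (Eventually.of_forall fun x => ?_)
        simp only [map_mul]; ring
    · intro i _
      refine integrable_finsetSum _ fun j _ => ?_
      refine ((hint i j).const_mul (a i * (starRingEnd ℂ) (a j))).congr
        (Eventually.of_forall fun x => ?_)
      simp only [map_mul]; ring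
  have h2 : ∫ x, ‖∑ i ∈ s, a i * u i x‖ ^ 2 ∂μ ≤ ∑ q ∈ s ×ˢ s, ‖c q.1 q.2‖ := by
    rw [Finset.sum_product]
    refine (le_abs_self _).trans ?_
    rw [← Real.norm_eq_abs, ← Complex.norm_real, h1]
    refine (norm_sum_le _ _).trans (Finset.sum_le_sum fun i _ => (norm_sum_le _ _).trans
      (Finset.sum_le_sum fun j _ => ?_))
    rw [norm_mul, norm_mul, RCLike.norm_conj]
    exact mul_le_of_le_one_left (norm_nonneg _) (mul_le_one₀ (ha i) (norm_nonneg _) (ha j))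
  have h3 : ∑ q ∈ s ×ˢ s, ‖c q.1 q.2‖ ^ 2
      = ∫ z, ‖∑ i ∈ s, u i z.1 * (starRingEnd ℂ) (u i z.2)‖ ^ 2 ∂(μ.prod μ) := by
    rw [← Complex.ofReal_inj, ← integral_complex_ofReal]
    simp only [hsq]
    have hfac : ∀ i j (z : X × X), u i z.1 * (starRingEnd ℂ) (u i z.2) *
        (starRingEnd ℂ) (u j z.1 * (starRingEnd ℂ) (u j z.2))
        = (u i z.1 * (starRingEnd ℂ) (u j z.1)) * (u j z.2 * (starRingEnd ℂ) (u i z.2)) :=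
      fun i j z => by simp only [map_mul, Complex.conj_conj]; ring
    simp only [hfac]
    have hint2 : ∀ i j, Integrable (fun z : X × X => (u i z.1 * (starRingEnd ℂ) (u j z.1)) *
        (u j z.2 * (starRingEnd ℂ) (u i z.2))) (μ.prod μ) := fun i j =>
      (hint i j).mul_prod (hint j i)
    rw [integral_finsetSum _ fun i _ => integrable_finsetSum _ fun j _ => hint2 i j,
      Finset.sum_product, Complex.ofReal_sum]
    refine Finset.sum_congr rfl fun i _ => ?_
    rw [integral_finsetSum _ fun j _ => hint2 i j, Complex.ofReal_sum]
    refine Finset.sum_congr rfl fun j _ => ?_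
    rw [integral_prod_mul (fun x => u i x * (starRingEnd ℂ) (u j x))
      (fun y => u j y * (starRingEnd ℂ) (u i y)), Complex.ofReal_pow, ← Complex.mul_conj']
    congr 1
    simp only [hc]
    rw [← integral_conj]
    refine integral_congr_ae (Eventually.of_forall fun x => ?_)
    simp only [map_mul, Complex.conj_conj]; ring
  have h0 : 0 ≤ ∫ x, ‖∑ i ∈ s, a i * u i x‖ ^ 2 ∂μ := integral_nonneg fun x => by positivity
  calc _ ≤ (∑ q ∈ s ×ˢ s, ‖c q.1 q.2‖) ^ 2 := by gcongr
    _ ≤ ((s ×ˢ s).card : ℝ) * ∑ q ∈ s ×ˢ s, ‖c q.1 q.2‖ ^ 2 := sq_sum_le_card_mul_sum_sq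
    _ = _ := by rw [h3, Finset.card_product]; push_cast; ring

lemma norm_cesaroMean_le {b : ℕ → ℂ} {B : ℝ} (hB0 : 0 ≤ B) (hb : ∀ n, ‖b n‖ ≤ B) (N : ℕ) :
    ‖cesaroMean b N‖ ≤ B := by
  refine le_trans ?_ (cesaroMean_const_le hB0 N)
  rw [cesaroMean, cesaroMean, norm_mul]
  gcongr
  · simp
  · exact (norm_sum_le _ _).trans (Finset.sum_le_sum fun _ _ => hb _)

/-- For a weakly mixing `T` and a bounded function `g` of mean zero, the Cesàro means of
`a n • g ∘ T^[n]` tend to zero in `L²` for all bounded coefficients `a`. This follows from the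
pointwise ergodic theorem for `T × T` and the tensor square of `g`. -/
lemma IsWeaklyMixing.tendsto_integral_norm_cesaroMean_sq [IsProbabilityMeasure μ] {T : X → X}
    (hT : IsWeaklyMixing T μ) {g : X → ℂ} (hg : Measurable g) {B : ℝ} (hB : ∀ x, ‖g x‖ ≤ B)
    (h0 : ∫ x, g x ∂μ = 0) {a : ℕ → ℂ} (ha : ∀ n, ‖a n‖ ≤ 1) :
    Tendsto (fun N => ∫ x, ‖cesaroMean (fun n => a n * g (T^[n] x)) N‖ ^ 2 ∂μ) atTop (𝓝 0) := by
  have hTm := hT.measurePreserving.measurable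
  set G : X × X → ℂ := fun z => g z.1 * (starRingEnd ℂ) (g z.2) with hG
  have hGm : Measurable G := (hg.comp measurable_fst).mul
    (Complex.continuous_conj.measurable.comp (hg.comp measurable_snd))
  have hGB : ∀ z, ‖G z‖ ≤ B * B := fun z => by
    rw [hG, norm_mul, RCLike.norm_conj]
    exact mul_le_mul (hB _) (hB _) (norm_nonneg _) ((norm_nonneg _).trans (hB z.1))
  have hGint : Integrable G (μ.prod μ) :=
    Integrable.of_bound hGm.aestronglyMeasurable (B * B) (Eventually.of_forall hGB)
  have hG0 : ∫ z, G z ∂(μ.prod μ) = 0 := by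
    rw [hG, integral_prod_mul g fun y => (starRingEnd ℂ) (g y), h0, zero_mul]
  have hiter : ∀ n (z : X × X), (Prod.map T T)^[n] z = (T^[n] z.1, T^[n] z.2) := fun n z => by
    rw [Prod.map_iterate]; rfl
  have hBB : 0 ≤ B * B := mul_self_nonneg B
  have hlim : Tendsto (fun N => ∫ z, ‖cesaroMean (fun n => G ((Prod.map T T)^[n] z)) N‖ ^ 2
      ∂(μ.prod μ)) atTop (𝓝 0) := by
    rw [← integral_zero (X × X) ℝ (μ := μ.prod μ)]
    refine tendsto_integral_of_dominated_convergence (fun _ => (B * B) ^ 2) (fun N => ?_)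
      (integrable_const _) (fun N => Eventually.of_forall fun z => ?_) ?_
    · refine Measurable.aestronglyMeasurable ?_
      refine Measurable.pow_const (Measurable.norm ?_) 2
      exact (Finset.measurable_sum _ fun n _ =>
        hGm.comp ((hTm.prodMap hTm).iterate n)).const_mul _
    · rw [Real.norm_eq_abs, abs_of_nonneg (by positivity)]
      gcongr
      exact norm_cesaroMean_le hBB (fun n => hGB _) N
    · filter_upwards [ae_tendsto_cesaroMean_comp_iterate hT.ergodic_prod hGm hGint] with z hz
      rw [hG0] at hz
      simpa using hz.norm.pow 2
  have hle : ∀ N, ∫ x, ‖cesaroMean (fun n => a n * g (T^[n] x)) N‖ ^ 2 ∂μ ≤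
      Real.sqrt (∫ z, ‖cesaroMean (fun n => G ((Prod.map T T)^[n] z)) N‖ ^ 2 ∂(μ.prod μ)) := by
    intro N
    refine Real.le_sqrt_of_sq_le ?_
    have key := sq_integral_norm_sum_mul_sq_le (μ := μ) (Finset.Icc 1 N)
      (u := fun n x => g (T^[n] x)) (fun n => hg.comp (hTm.iterate n)) (fun n x => hB _) ha
    simp only [cesaroMean, norm_mul, mul_pow, integral_const_mul, hiter, hG]
    rw [Nat.card_Icc, Nat.add_sub_cancel] at key
    rcases Nat.eq_zero_or_pos N with rfl | hN
    · simp
    have hN' : (N : ℝ) ≠ 0 := by positivity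
    have hn : ‖(1 / (N : ℂ))‖ = 1 / (N : ℝ) := by simp
    rw [hn]
    refine (mul_le_mul_of_nonneg_left key (by positivity : 0 ≤ ((1 / (N : ℝ)) ^ 2) ^ 2)).trans_eq ?_
    field_simp
  refine squeeze_zero (fun N => integral_nonneg fun x => by positivity) hle ?_
  simpa using hlim.sqrt

end WeakMixing

/-! ### Weak convergence of orbits to zero in the Cesàro sense -/

section WeakOrbit

variable {X : Type*} [MeasurableSpace X] {μ : Measure X} [IsProbabilityMeasure μ] {p : ℝ≥0∞}

/-- Uniformly bounded functions that tend to zero in `L²` tend to zero in every `L^p`, `p < ∞`. -/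
lemma tendsto_eLpNorm_of_bounded_of_tendsto_integral_sq (hp : p ≠ ∞) {h : ℕ → X → ℂ}
    (hm : ∀ N, AEStronglyMeasurable (h N) μ) {B : ℝ} (hB : ∀ N x, ‖h N x‖ ≤ B)
    (h2 : Tendsto (fun N => ∫ x, ‖h N x‖ ^ 2 ∂μ) atTop (𝓝 0)) :
    Tendsto (fun N => eLpNorm (h N) p μ) atTop (𝓝 0) := by
  obtain ⟨m, hpm⟩ : ∃ m : ℕ, p ≤ m := ENNReal.exists_nat_gt hp |>.imp fun _ => le_of_lt
  have hle : ∀ N, eLpNorm (h N) p μ ≤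
      ENNReal.ofReal (B ^ m * ∫ x, ‖h N x‖ ^ 2 ∂μ) ^ (1 / ((m + 2 : ℕ) : ℝ)) := fun N => by
    have hq : p ≤ ((m + 2 : ℕ) : ℝ≥0∞) := hpm.trans (by exact_mod_cast Nat.le_add_right m 2)
    refine (eLpNorm_le_eLpNorm_of_exponent_le hq (hm N)).trans ?_
    rw [eLpNorm_eq_lintegral_rpow_enorm_toReal (by positivity) (ENNReal.natCast_ne_top _),
      ENNReal.toReal_natCast]
    gcongr
    rw [← integral_const_mul, ofReal_integral_eq_lintegral_ofReal]
    · refine lintegral_mono fun x => ?_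
      have hB0 : 0 ≤ B := (norm_nonneg _).trans (hB N x)
      rw [ENNReal.rpow_natCast, ← ofReal_norm, ← ENNReal.ofReal_pow (norm_nonneg _)]
      refine ENNReal.ofReal_le_ofReal ?_
      rw [pow_add]
      gcongr
      exact hB N x
    · refine Integrable.const_mul ?_ _
      refine Integrable.of_bound ((hm N).norm.pow 2) (B ^ 2) (Eventually.of_forall fun x => ?_)
      rw [norm_pow, norm_norm]
      gcongr
      exact hB N x
    · refine Eventually.of_forall fun x => ?_
      have hB0 : 0 ≤ B := (norm_nonneg _).trans (hB N x)
      simp only [Pi.zero_apply]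
      positivity
  refine tendsto_of_tendsto_of_tendsto_of_le_of_le tendsto_const_nhds ?_ (fun N => zero_le) hle
  have h3 := (ENNReal.continuous_ofReal.tendsto _).comp (h2.const_mul (B ^ m))
  have h4 := ((ENNReal.continuous_rpow_const (y := 1 / ((m + 2 : ℕ) : ℝ))).tendsto _).comp h3
  have h5 : (0 : ℝ) < 1 / ((m + 2 : ℕ) : ℝ) := by positivity
  rw [mul_zero, ENNReal.ofReal_zero, ENNReal.zero_rpow_of_pos h5] at h4
  exact h4

variable [Fact (1 ≤ p)]

lemma norm_integral_Lp_le (g : Lp ℂ p μ) : ‖∫ x, g x ∂μ‖ ≤ ‖g‖ := by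
  refine (norm_integral_le_integral_norm _).trans ?_
  rw [integral_norm_eq_lintegral_enorm (Lp.aestronglyMeasurable g), Lp.norm_def,
    ← eLpNorm_one_eq_lintegral_enorm]
  exact ENNReal.toReal_mono (Lp.eLpNorm_ne_top g)
    (eLpNorm_le_eLpNorm_of_exponent_le Fact.out (Lp.aestronglyMeasurable g))

lemma integrable_coeFn_Lp (g : Lp ℂ p μ) : Integrable g μ :=
  (Lp.memLp g).integrable Fact.out

variable {T : X → X}

lemma IsWeaklyMixing.cesaroNull_norm_apply_of_bounded (hp : p ≠ ∞) (hT : IsWeaklyMixing T μ)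
    {g : X → ℂ} (hg : Measurable g) {B : ℝ} (hB : ∀ x, ‖g x‖ ≤ B) (h0 : ∫ x, g x ∂μ = 0)
    (hgp : MemLp g p μ) (φ : Lp ℂ p μ →L[ℂ] ℂ) :
    CesaroNull fun n => ‖φ ((koopman p hT.measurePreserving ^ n) (hgp.toLp g))‖ := by
  set S := koopman p hT.measurePreserving with hS
  set z : ℕ → ℂ := fun n => φ ((S ^ n) (hgp.toLp g)) with hz
  -- Unimodular coefficients turn the mean of `‖φ (S ^ n g)‖` into `φ` of a weighted mean.
  set a : ℕ → ℂ := fun n => (starRingEnd ℂ) (z n) / ‖z n‖ with ha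
  have ha1 : ∀ n, ‖a n‖ ≤ 1 := fun n => by
    rw [ha, norm_div, RCLike.norm_conj, Complex.norm_real, norm_norm]
    exact div_self_le_one _
  have haz : ∀ n, a n * z n = ‖z n‖ := fun n => by
    by_cases h : z n = 0
    · simp [h]
    · have : (‖z n‖ : ℂ) ≠ 0 := by simpa using h
      rw [ha, div_mul_eq_mul_div, Complex.conj_mul', sq, mul_div_assoc, div_self this, mul_one]
  set H : ℕ → Lp ℂ p μ := fun N =>
    (1 / (N : ℂ)) • ∑ n ∈ Finset.Icc 1 N, a n • (S ^ n) (hgp.toLp g) with hH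
  have hφH : ∀ N, φ (H N) = (cesaroMean (fun n => ‖z n‖) N : ℝ) := fun N => by
    rw [cesaroMean, Complex.ofReal_mul, Complex.ofReal_sum,
      ← Finset.sum_congr rfl fun n _ => haz n, hH, map_smul, map_sum, smul_eq_mul]
    simp only [map_smul, smul_eq_mul, hz, Complex.ofReal_div, Complex.ofReal_one,
      Complex.ofReal_natCast]
  have hB0 : ∀ x : X, 0 ≤ B := fun x => (norm_nonneg _).trans (hB x)
  have hcoe : ∀ N, (H N : X → ℂ) =ᵐ[μ] fun x => cesaroMean (fun n => a n * g (T^[n] x)) N := by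
    intro N
    have h1 : ∀ n, ∀ᵐ x ∂μ, (a n • (S ^ n) (hgp.toLp g) : Lp ℂ p μ) x = a n * g (T^[n] x) := by
      intro n
      filter_upwards [Lp.coeFn_smul (a n) ((S ^ n) (hgp.toLp g)),
        coeFn_koopman_pow hT.measurePreserving n (hgp.toLp g),
        (hT.measurePreserving.iterate n).quasiMeasurePreserving.ae hgp.coeFn_toLp] with x e1 e2 e3
      rw [e1, Pi.smul_apply, e2, Function.comp_apply, e3, smul_eq_mul]
    filter_upwards [ae_all_iff.2 h1, Lp.coeFn_smul (1 / (N : ℂ))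
      (∑ n ∈ Finset.Icc 1 N, a n • (S ^ n) (hgp.toLp g)),
      Lp.coeFn_finsetSum (Finset.Icc 1 N) fun n => a n • (S ^ n) (hgp.toLp g)] with x e1 e2 e3
    rw [hH, e2, Pi.smul_apply, e3, Finset.sum_apply, cesaroMean, smul_eq_mul]
    simp only [e1]
  have hlim : Tendsto (fun N => ‖H N‖) atTop (𝓝 0) := by
    have hTm := hT.measurePreserving.measurable
    have := tendsto_eLpNorm_of_bounded_of_tendsto_integral_sq (μ := μ) hp (B := B)
      (h := fun N x => cesaroMean (fun n => a n * g (T^[n] x)) N) (fun N =>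
        ((Finset.measurable_sum _ fun n _ =>
          (hg.comp (hTm.iterate n)).const_mul (a n)).const_mul _).aestronglyMeasurable)
      (fun N x => norm_cesaroMean_le (hB0 x) (fun n => by
        rw [norm_mul]
        exact (mul_le_of_le_one_left (norm_nonneg _) (ha1 n)).trans (hB _)) N)
      (hT.tendsto_integral_norm_cesaroMean_sq hg hB h0 ha1)
    have h2 := (ENNReal.tendsto_toReal ENNReal.zero_ne_top).comp this
    refine h2.congr fun N => ?_
    rw [Lp.norm_def, eLpNorm_congr_ae (hcoe N)]
    rfl
  have h3 : Tendsto (fun N => φ (H N)) atTop (𝓝 0) := by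
    have := (φ.continuous.tendsto 0).comp (tendsto_zero_iff_norm_tendsto_zero.2 hlim)
    rwa [map_zero] at this
  have h4 := h3.norm
  rw [norm_zero] at h4
  refine h4.congr fun N => ?_
  rw [hφH, Complex.norm_real, Real.norm_eq_abs,
    abs_of_nonneg (cesaroMean_nonneg (fun n => norm_nonneg _) N)]

/-- Orbits of mean zero functions under a weakly mixing Koopman operator on `L^p` converge weakly to
zero in the absolute Cesàro sense. -/
lemma IsWeaklyMixing.cesaroNull_norm_apply (hp : p ≠ ∞) (hT : IsWeaklyMixing T μ)
    (g : Lp ℂ p μ) (h0 : ∫ x, g x ∂μ = 0) (φ : Lp ℂ p μ →L[ℂ] ℂ) :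
    CesaroNull fun n => ‖φ ((koopman p hT.measurePreserving ^ n) g)‖ := by
  refine CesaroNull.of_forall_le_add (fun n => norm_nonneg _) fun τ hτ => ?_
  -- The orbit of `g` is compared with that of a simple function, corrected to have mean zero.
  set η : ℝ := τ / (2 * (‖φ‖ + 1)) with hη
  have hη0 : 0 < η := by positivity
  obtain ⟨s, hs, hsp⟩ := (Lp.memLp g).exists_simpleFunc_eLpNorm_sub_lt hp
    (ENNReal.ofReal_pos.2 hη0).ne'
  set c : ℂ := ∫ x, s x ∂μ with hc
  have hbp : MemLp (fun x => s x - c) p μ := hsp.sub (memLp_const c)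
  obtain ⟨B, hB⟩ := s.exists_forall_norm_le
  have hsg : ‖g - hsp.toLp s‖ ≤ η := by
    rw [Lp.norm_def]
    refine ENNReal.toReal_le_of_le_ofReal hη0.le ?_
    refine (eLpNorm_congr_ae ?_).trans_le hs.le
    filter_upwards [Lp.coeFn_sub g (hsp.toLp s), hsp.coeFn_toLp] with x e1 e2
    rw [e1, Pi.sub_apply, e2, Pi.sub_apply]
  have hcη : ‖c‖ ≤ η := by
    refine le_trans ?_ hsg
    refine le_trans (le_of_eq ?_) (norm_integral_Lp_le _)
    rw [integral_congr_ae (Lp.coeFn_sub g (hsp.toLp s))]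
    simp only [Pi.sub_apply]
    rw [integral_sub (integrable_coeFn_Lp _) (integrable_coeFn_Lp _), h0, zero_sub, norm_neg,
      integral_congr_ae hsp.coeFn_toLp]
  have hdist : ‖g - hbp.toLp _‖ ≤ 2 * η := by
    have e : g - hbp.toLp _ = (g - hsp.toLp s) + (memLp_const c).toLp (fun _ => c) := by
      have : hbp.toLp _ = hsp.toLp s - (memLp_const c).toLp (fun _ => c) := rfl
      rw [this]; abel
    rw [e]
    refine (norm_add_le _ _).trans ?_
    have : ‖((memLp_const c).toLp (fun _ => c) : Lp ℂ p μ)‖ ≤ ‖c‖ := by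
      have := Lp.norm_const_le (p := p) (μ := μ) (c := c)
      simpa using this
    linarith
  refine ⟨_, hT.cesaroNull_norm_apply_of_bounded hp (s.measurable.sub_const c)
    (B := B + ‖c‖) (fun x => (norm_sub_le _ _).trans (by gcongr; exact hB x)) ?_ hbp φ, fun n => ?_⟩
  · rw [integral_sub (hsp.integrable Fact.out) (integrable_const _)]
    simp [hc]
  · have e : φ ((koopman p hT.measurePreserving ^ n) g)
        = φ ((koopman p hT.measurePreserving ^ n) (g - hbp.toLp _))
          + φ ((koopman p hT.measurePreserving ^ n) (hbp.toLp _)) := by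
      rw [map_sub, map_sub]; ring
    rw [e]
    refine (norm_add_le _ _).trans ?_
    gcongr
    refine (φ.le_opNorm _).trans ?_
    have h1 := (norm_koopman_pow_le hT.measurePreserving n (g - hbp.toLp _)).trans hdist
    calc ‖φ‖ * _ ≤ (‖φ‖ + 1) * (2 * η) := by gcongr; linarith
      _ = τ := by rw [hη]; field_simp

end WeakOrbit

/-! ### Removing a finite-dimensional part that tends weakly to zero -/

/-- Let `K` be a closed convex symmetric set, `u n` a bounded sequence in a finite-dimensional
subspace and `r n ∈ K`. If `u n + r n` tends weakly to zero in the absolute Cesàro sense, then `u n`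
approaches `K ∩ U` in norm, in the Cesàro sense. Away from `K ∩ U` the bounded part of `U` is
compact, and each of its points is separated from `K` by a functional; finitely many of these
detect every `n` for which `u n` is far from `K ∩ U`. -/
lemma exists_approx_of_cesaroNull_apply {E : Type*} [NormedAddCommGroup E] [NormedSpace ℂ E]
    {K : Set E} (hKc : IsClosed K) (hK : Convex ℝ K) (hK0 : (0 : E) ∈ K)
    (hKneg : ∀ x ∈ K, -x ∈ K) (U : Submodule ℂ E) [FiniteDimensional ℂ U] {u : ℕ → U}
    {M : ℝ} (hu : ∀ n, ‖u n‖ ≤ M) {r : ℕ → E} (hr : ∀ n, r n ∈ K)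
    (hφ : ∀ φ : E →L[ℂ] ℂ, CesaroNull fun n => ‖φ (u n + r n)‖) :
    ∃ v : ℕ → U, (∀ n, (v n : E) ∈ K) ∧ (∀ n, ‖u n - v n‖ ≤ M) ∧
      CesaroNull fun n => ‖u n - v n‖ := by
  have : ProperSpace U := FiniteDimensional.proper ℂ U
  set K' : Set U := Subtype.val ⁻¹' K with hK'
  have hK'c : IsClosed K' := hKc.preimage continuous_subtype_val
  have h0K' : (0 : U) ∈ K' := hK0
  -- `v n` is a point of `K ∩ U` nearest to `u n`.
  choose v hvK hv using fun n => hK'c.exists_infDist_eq_dist ⟨0, h0K'⟩ (u n)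
  have hd : ∀ n, ‖u n - v n‖ = Metric.infDist (u n) K' := fun n => by rw [hv, dist_eq_norm]
  have hdM : ∀ n, ‖u n - v n‖ ≤ M := fun n => by
    rw [hd]
    exact (Metric.infDist_le_dist_of_mem h0K').trans (by simpa using hu n)
  refine ⟨v, hvK, hdM, CesaroNull.of_forall_le_add (fun n => norm_nonneg _) fun τ hτ => ?_⟩
  have hM0 : 0 ≤ M := (norm_nonneg _).trans (hu 0)
  set B : Set U := Metric.closedBall 0 M ∩ {x | τ ≤ Metric.infDist x K'} with hB
  have hBc : IsCompact B := (isCompact_closedBall 0 M).inter_right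
    (isClosed_le continuous_const (Metric.continuous_infDist_pt K'))
  have key : ∃ b : ℕ → ℝ, (∀ n, 0 ≤ b n) ∧ CesaroNull b ∧ ∀ n, u n ∈ B → 1 ≤ b n := by
    -- Each point of `B` has a neighbourhood in which one functional detects the `u n`.
    refine hBc.induction_on (p := fun s => ∃ b : ℕ → ℝ, (∀ n, 0 ≤ b n) ∧ CesaroNull b ∧
      ∀ n, u n ∈ s → 1 ≤ b n) ?_ ?_ ?_ ?_
    · exact ⟨fun _ => 0, fun _ => le_rfl, CesaroNull.zero, fun n hn => hn.elim⟩
    · rintro s t hst ⟨b, hb0, hb, hbt⟩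
      exact ⟨b, hb0, hb, fun n hn => hbt n (hst hn)⟩
    · rintro s t ⟨b, hb0, hb, hbs⟩ ⟨c, hc0, hc, hct⟩
      refine ⟨_, fun n => add_nonneg (hb0 n) (hc0 n), hb.add hc, fun n hn => ?_⟩
      rcases hn with hn | hn
      · linarith [hbs n hn, hc0 n]
      · linarith [hct n hn, hb0 n]
    · intro x hx
      have hxK : (x : E) ∉ K := fun h => by
        have h1 : Metric.infDist x K' = 0 := Metric.infDist_zero_of_mem (s := K') h
        have h2 : τ ≤ Metric.infDist x K' := hx.2
        linarith
      obtain ⟨φ, s, hφK, hφx⟩ :=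
        RCLike.geometric_hahn_banach_closed_point (𝕜 := ℂ) hK hKc hxK
      set δ : ℝ := RCLike.re (φ x) - s with hδ
      have hδ0 : 0 < δ := sub_pos.2 hφx
      have hcont : Continuous fun y : U => RCLike.re (φ (y : E)) :=
        RCLike.continuous_re.comp (φ.continuous.comp continuous_subtype_val)
      refine ⟨{y : U | s + δ / 2 < RCLike.re (φ (y : E))}, mem_nhdsWithin_of_mem_nhds
        ((isOpen_lt continuous_const hcont).mem_nhds ?_), _, fun n => ?_,
        (hφ φ).const_mul (2 / δ), fun n hn => ?_⟩
      · change s + δ / 2 < RCLike.re (φ (x : E))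
        linarith
      · positivity
      · have h1 : s + δ / 2 < RCLike.re (φ (u n : E)) := hn
        -- By symmetry of `K`, the separating bound applies to `-r n`.
        have h2 := hφK _ (hKneg _ (hr n))
        have h3 : RCLike.re (φ (u n + r n)) ≤ ‖φ (u n + r n)‖ := RCLike.re_le_norm _
        rw [map_add, map_add] at h3
        rw [map_neg, map_neg] at h2
        have h4 : δ / 2 ≤ ‖φ (u n + r n)‖ := by
          rw [map_add]
          linarith
        calc (1 : ℝ) = 2 / δ * (δ / 2) := by field_simp
          _ ≤ _ := by gcongr
  obtain ⟨b, hb0, hb, hbB⟩ := key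
  refine ⟨_, hb.const_mul M, fun n => ?_⟩
  by_cases hn : τ ≤ ‖u n - v n‖
  · have : u n ∈ B := ⟨by simpa using hu n, by rw [hd] at hn; exact hn⟩
    nlinarith [hbB n this, hdM n]
  · push Not at hn
    have := mul_nonneg hM0 (hb0 n)
    linarith

/-! ### The structure of orbits under twisted compactness -/

section Decomposition

variable {X : Type*} [MeasurableSpace X] {μ : Measure X} {p : ℝ≥0∞}

/-- The ball of radius `ε` of `L^∞`, as a subset of `L^p`. -/
def linftyBall (μ : Measure X) (p : ℝ≥0∞) (ε : ℝ) : Set (Lp ℂ p μ) :=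
  {g | ∀ᵐ x ∂μ, ‖g x‖ ≤ ε}

lemma eLpNorm_top_le_ofReal_iff {ε : ℝ} (hε : 0 ≤ ε) (g : X → ℂ) :
    eLpNorm g ∞ μ ≤ ENNReal.ofReal ε ↔ ∀ᵐ x ∂μ, ‖g x‖ ≤ ε := by
  have e : ∀ x, ‖g x‖ₑ ≤ ENNReal.ofReal ε ↔ ‖g x‖ ≤ ε := fun x => by
    rw [← ofReal_norm, ENNReal.ofReal_le_ofReal_iff hε]
  rw [eLpNorm_exponent_top]
  constructor
  · intro h
    filter_upwards [ae_le_eLpNormEssSup (f := g) (μ := μ)] with x hx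
    exact (e x).1 (hx.trans h)
  · intro h
    exact essSup_le_of_ae_le _ (h.mono fun x hx => (e x).2 hx)

lemma convex_linftyBall (ε : ℝ) : Convex ℝ (linftyBall μ p ε) := by
  intro f hf g hg a b ha hb hab
  filter_upwards [hf, hg, Lp.coeFn_add (a • f) (b • g), Lp.coeFn_smul a f, Lp.coeFn_smul b g]
    with x h1 h2 e1 e2 e3
  rw [e1, Pi.add_apply, e2, e3, Pi.smul_apply, Pi.smul_apply]
  refine (norm_add_le _ _).trans ?_
  rw [norm_smul, norm_smul, Real.norm_of_nonneg ha, Real.norm_of_nonneg hb]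
  calc a * ‖f x‖ + b * ‖g x‖ ≤ a * ε + b * ε := by gcongr
    _ = ε := by rw [← add_mul, hab, one_mul]

lemma zero_mem_linftyBall {ε : ℝ} (hε : 0 ≤ ε) : (0 : Lp ℂ p μ) ∈ linftyBall μ p ε := by
  filter_upwards [Lp.coeFn_zero ℂ p μ] with x hx
  rw [hx]
  simpa

lemma neg_mem_linftyBall {ε : ℝ} {g : Lp ℂ p μ} (hg : g ∈ linftyBall μ p ε) :
    -g ∈ linftyBall μ p ε := by
  filter_upwards [hg, Lp.coeFn_neg g] with x h1 h2
  rwa [h2, Pi.neg_apply, norm_neg]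

lemma add_mem_linftyBall {ε δ : ℝ} {f g : Lp ℂ p μ} (hf : f ∈ linftyBall μ p ε)
    (hg : g ∈ linftyBall μ p δ) : f + g ∈ linftyBall μ p (ε + δ) := by
  filter_upwards [hf, hg, Lp.coeFn_add f g] with x h1 h2 h3
  rw [h3, Pi.add_apply]
  exact (norm_add_le _ _).trans (add_le_add h1 h2)

lemma norm_le_of_mem_linftyBall [IsProbabilityMeasure μ] {ε : ℝ} (hε : 0 ≤ ε) {g : Lp ℂ p μ}
    (hg : g ∈ linftyBall μ p ε) : ‖g‖ ≤ ε := by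
  have := Lp.norm_le_of_ae_bound hε hg
  simpa [measureUnivNNReal] using this

variable [Fact (1 ≤ p)]

lemma isClosed_linftyBall (ε : ℝ) : IsClosed (linftyBall μ p ε) := by
  refine IsSeqClosed.isClosed fun g g₀ hg hlim => ?_
  obtain ⟨ns, -, hns⟩ := (tendstoInMeasure_of_tendsto_Lp hlim).exists_seq_tendsto_ae
  filter_upwards [hns, ae_all_iff.2 hg] with x hx hgx
  exact le_of_tendsto' hx.norm fun i => hgx _

variable [IsProbabilityMeasure μ]

/-- A mean zero orbit `A S^n f` is, up to a uniformly small error in `L^∞`, a combination of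
finitely many fixed functions with bounded coefficients that are null in the absolute Cesàro sense. -/
lemma TwistedCompact.exists_decomposition_of_integral_eq_zero (hp : p ≠ ∞) {T : X → X}
    (hT : IsWeaklyMixing T μ) {A : Lp ℂ p μ →L[ℂ] Lp ℂ p μ}
    (hA : TwistedCompact A (koopman p hT.measurePreserving)) {f : Lp ℂ p μ}
    (h0 : ∫ x, f x ∂μ = 0) {ε : ℝ} (hε : 0 < ε) :
    ∃ (m : ℕ) (g : Fin m → Lp ℂ p μ) (c : Fin m → ℕ → ℂ) (r : ℕ → Lp ℂ p μ),
      (∀ n, A ((koopman p hT.measurePreserving ^ n) f) = ∑ i, c i n • g i + r n) ∧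
      (∀ n, r n ∈ linftyBall μ p ε) ∧ (∀ i, ∃ M, ∀ n, ‖c i n‖ ≤ M) ∧
      ∀ i, CesaroNull fun n => ‖c i n‖ := by
  set S := koopman p hT.measurePreserving with hS
  obtain ⟨U, R, h, hU, hR⟩ := hA f (ε / 2) (by positivity)
  set r : ℕ → Lp ℂ p μ := fun n => R.projection U h (A ((S ^ n) f)) with hr
  have hrK : ∀ n, r n ∈ linftyBall μ p (ε / 2) := fun n =>
    (eLpNorm_top_le_ofReal_iff (by positivity) _).1 (hR n).le
  have hmem : ∀ n, A ((S ^ n) f) - r n ∈ U := fun n => by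
    rw [← Submodule.projection_apply_eq_zero_iff h, map_sub, sub_eq_zero, hr,
      Submodule.projection_apply_of_mem_left h (Submodule.projection_apply_mem h _)]
  set u : ℕ → U := fun n => ⟨_, hmem n⟩ with hu
  have hur : ∀ n, (u n : Lp ℂ p μ) + r n = A ((S ^ n) f) := fun n => sub_add_cancel _ _
  have huM : ∀ n, ‖u n‖ ≤ ‖A‖ * ‖f‖ + ε / 2 := fun n => by
    refine (norm_sub_le (A ((S ^ n) f)) (r n)).trans ?_
    gcongr
    · exact (A.le_opNorm _).trans (by gcongr; exact norm_koopman_pow_le _ n f)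
    · exact norm_le_of_mem_linftyBall (by positivity) (hrK n)
  obtain ⟨v, hvK, hvM, hv0⟩ := exists_approx_of_cesaroNull_apply
    (isClosed_linftyBall (μ := μ) (p := p) (ε / 2)) (convex_linftyBall _)
    (zero_mem_linftyBall (by positivity)) (fun _ => neg_mem_linftyBall) U huM hrK (fun φ => by
      simp only [hur]
      exact hT.cesaroNull_norm_apply hp f h0 (φ.comp A))
  set b := Module.finBasis ℂ U with hb
  set L : Fin (Module.finrank ℂ U) → U →L[ℂ] ℂ := fun i => (b.coord i).toContinuousLinearMap with hL
  have hLle : ∀ i n, ‖L i (u n - v n)‖ ≤ ‖L i‖ * ‖u n - v n‖ := fun i n => (L i).le_opNorm _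
  refine ⟨_, fun i => (b i : Lp ℂ p μ), fun i n => L i (u n - v n), fun n => v n + r n,
    fun n => ?_, fun n => ?_, fun i => ⟨‖L i‖ * (‖A‖ * ‖f‖ + ε / 2), fun n => ?_⟩, fun i => ?_⟩
  · have h1 : ∑ i, L i (u n - v n) • (b i : Lp ℂ p μ) = (u n : Lp ℂ p μ) - v n := by
      have := congrArg (Subtype.val) (b.sum_repr (u n - v n))
      rw [Submodule.coe_sub] at this
      rw [← this]
      simp [hL]
    have h2 : ∀ a b c : Lp ℂ p μ, a + b = a - c + (c + b) := fun a b c => by abel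
    rw [h1, ← hur]
    exact h2 _ _ _
  · have := add_mem_linftyBall (hvK n) (hrK n)
    rwa [add_halves] at this
  · exact (hLle i n).trans (by gcongr; exact hvM n)
  · exact CesaroNull.mono (fun n => norm_nonneg _) (hLle i) (hv0.const_mul _)

lemma koopman_pow_const {T : X → X} (hT : MeasurePreserving T μ μ) (n : ℕ) (c : ℂ) :
    (koopman p hT ^ n) (Lp.const p μ c) = Lp.const p μ c := by
  refine Lp.ext ?_
  filter_upwards [coeFn_koopman_pow hT n (Lp.const p μ c), Lp.coeFn_const p μ c,
    (hT.iterate n).quasiMeasurePreserving.ae (Lp.coeFn_const p μ c)] with x e1 e2 e3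
  rw [e1, Function.comp_apply, e3, e2]
  rfl

/-- The orbit `A S^n f` equals `(∫ f) A 1` plus a combination of finitely many fixed functions with
bounded coefficients that are null in the absolute Cesàro sense, up to a uniformly small error in
`L^∞`. -/
lemma TwistedCompact.exists_decomposition (hp : p ≠ ∞) {T : X → X}
    (hT : IsWeaklyMixing T μ) {A : Lp ℂ p μ →L[ℂ] Lp ℂ p μ}
    (hA : TwistedCompact A (koopman p hT.measurePreserving)) (f : Lp ℂ p μ)
    {ε : ℝ} (hε : 0 < ε) :
    ∃ (m : ℕ) (g : Fin m → Lp ℂ p μ) (c : Fin m → ℕ → ℂ) (r : ℕ → Lp ℂ p μ),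
      (∀ n, A ((koopman p hT.measurePreserving ^ n) f) =
        (∫ x, f x ∂μ) • A (Lp.const p μ 1) + ∑ i, c i n • g i + r n) ∧
      (∀ n, r n ∈ linftyBall μ p ε) ∧ (∀ i, ∃ M, ∀ n, ‖c i n‖ ≤ M) ∧
      ∀ i, CesaroNull fun n => ‖c i n‖ := by
  set I : ℂ := ∫ x, f x ∂μ with hI
  have h0 : ∫ x, (f - I • Lp.const p μ (1 : ℂ) : Lp ℂ p μ) x ∂μ = 0 := by
    have e : ((f - I • Lp.const p μ (1 : ℂ) : Lp ℂ p μ) : X → ℂ) =ᵐ[μ] fun x => f x - I := by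
      filter_upwards [Lp.coeFn_sub f (I • Lp.const p μ (1 : ℂ)),
        Lp.coeFn_smul I (Lp.const p μ (1 : ℂ)), Lp.coeFn_const p μ (1 : ℂ)] with x e1 e2 e3
      rw [e1, Pi.sub_apply, e2, Pi.smul_apply, e3]
      simp
    rw [integral_congr_ae e, integral_sub (integrable_coeFn_Lp f) (integrable_const _)]
    simp [hI]
  obtain ⟨m, g, c, r, h1, h2⟩ := hA.exists_decomposition_of_integral_eq_zero hp hT h0 hε
  refine ⟨m, g, c, r, fun n => ?_, h2⟩
  have h3 := h1 n
  rw [map_sub, map_smul, koopman_pow_const, map_sub, map_smul, sub_eq_iff_eq_add] at h3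
  rw [h3]
  abel

end Decomposition

/-! ### Weighted entangled averages -/

lemma tendsto_of_forall_approx {z : ℕ → ℂ} {L : ℂ}
    (h : ∀ ε : ℝ, 0 < ε → ∃ y : ℕ → ℂ, Tendsto y atTop (𝓝 L) ∧
      ∀ᶠ N in atTop, ‖z N - y N‖ ≤ ε) : Tendsto z atTop (𝓝 L) := by
  rw [Metric.tendsto_nhds]
  intro ε hε
  obtain ⟨y, hy, hyz⟩ := h (ε / 2) (by positivity)
  filter_upwards [hyz, Metric.tendsto_nhds.1 hy (ε / 2) (by positivity)] with N h1 h2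
  rw [← dist_eq_norm] at h1
  linarith [dist_triangle (z N) (y N) L]

section Entangled

variable {X : Type*} [MeasurableSpace X] {μ : Measure X} {p : ℝ≥0∞} [Fact (1 ≤ p)]

/-- The factors `A j * S j ^ e j` of the entangled product enlarge the `L^∞` norm at most by `C`
each, and the last factor does not enlarge it. -/
lemma entangledProduct_mem_linftyBall {C : ℝ} (hC : 0 ≤ C) (d : ℕ)
    {S : Fin (d + 1) → Lp ℂ p μ →L[ℂ] Lp ℂ p μ} {A : Fin d → Lp ℂ p μ →L[ℂ] Lp ℂ p μ}
    (hS : ∀ i, ∃ (T : X → X) (hT : MeasurePreserving T μ μ), S i = koopman p hT)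
    (hA : ∀ (n : ℕ) (j : Fin d) (ε : ℝ) (g : Lp ℂ p μ), 0 ≤ ε → g ∈ linftyBall μ p ε →
      A j ((S j.castSucc ^ n) g) ∈ linftyBall μ p (C * ε))
    (e : Fin (d + 1) → ℕ) {ε : ℝ} (hε : 0 ≤ ε) {g : Lp ℂ p μ} (hg : g ∈ linftyBall μ p ε) :
    entangledProduct d S A e g ∈ linftyBall μ p (C ^ d * ε) := by
  induction d generalizing ε g with
  | zero =>
    obtain ⟨T, hT, hST⟩ := hS 0
    rw [pow_zero, one_mul, entangledProduct, hST]
    filter_upwards [coeFn_koopman_pow hT (e 0) g,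
      (hT.iterate (e 0)).quasiMeasurePreserving.ae hg] with x h1 h2
    rwa [h1]
  | succ d ih =>
    have h1 := ih (S := fun i => S i.succ) (A := fun i => A i.succ) (fun i => hS i.succ)
      (fun n j => hA n j.succ) (fun i => e i.succ) (mul_nonneg hC hε) (hA (e 0) 0 ε g hε hg)
    rw [← mul_assoc, ← pow_succ] at h1
    exact h1

lemma JointlyLinftyBounded.exists_forall_mem_linftyBall {ι : Type*}
    {A S : ι → Lp ℂ p μ →L[ℂ] Lp ℂ p μ} (h : JointlyLinftyBounded A S) :
    ∃ C : ℝ, 0 ≤ C ∧ ∀ (n : ℕ) (j : ι) (ε : ℝ) (g : Lp ℂ p μ), 0 ≤ ε → g ∈ linftyBall μ p ε →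
      A j ((S j ^ n) g) ∈ linftyBall μ p (C * ε) := by
  obtain ⟨C, hC, h⟩ := h
  refine ⟨C, hC.le, fun n j ε g hε hg => ?_⟩
  have h1 := (eLpNorm_top_le_ofReal_iff hε _).2 hg
  have h2 := h n j g ⟨Lp.aestronglyMeasurable g, h1.trans_lt ENNReal.ofReal_lt_top⟩
  refine (eLpNorm_top_le_ofReal_iff (mul_nonneg hC.le hε) _).1 (h2.trans ?_)
  rw [ENNReal.ofReal_mul hC.le]
  gcongr

variable [IsProbabilityMeasure μ]

/-- The weighted pointwise ergodic theorem along one coordinate of the box. The function is split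
into a bounded part, on which the weights may be replaced by their mean, and an unbounded part of
small integral, to which the ergodic theorem is applied. -/
lemma ae_tendsto_boxMean_mul_comp_iterate {T : X → X} (hT : Ergodic T μ) {k : ℕ} (a : Fin k)
    {f : X → ℂ} (hfm : Measurable f) (hf : Integrable f μ) {W : (Fin k → ℕ) → ℂ} {c : ℂ} {M : ℝ}
    (hWM : ∀ n, ‖W n‖ ≤ M) (hWc : Tendsto (boxMean fun n => ‖W n - c‖) atTop (𝓝 0)) :
    ∀ᵐ x ∂μ, Tendsto (boxMean fun n => W n * f (T^[n a] x)) atTop (𝓝 (c * ∫ y, f y ∂μ)) := by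
  set F : ℕ → X → ℝ := fun l => {x | (l : ℝ) < ‖f x‖}.indicator fun x => ‖f x‖ with hF
  have hFs : ∀ l, MeasurableSet {x | (l : ℝ) < ‖f x‖} := fun l =>
    measurableSet_lt measurable_const hfm.norm
  have hFm : ∀ l, Measurable (F l) := fun l => hfm.norm.indicator (hFs l)
  have hFi : ∀ l, Integrable (F l) μ := fun l => hf.norm.indicator (hFs l)
  have hF0 : ∀ l x, 0 ≤ F l x := fun l x => Set.indicator_nonneg (fun _ _ => norm_nonneg _) x
  have hFle : ∀ l x, ‖f x‖ ≤ l + F l x := fun l x => by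
    by_cases hx : (l : ℝ) < ‖f x‖
    · have : F l x = ‖f x‖ := Set.indicator_of_mem (s := {x | (l : ℝ) < ‖f x‖}) hx _
      rw [this]
      linarith [(Nat.cast_nonneg l : (0 : ℝ) ≤ l)]
    · linarith [hF0 l x]
  have hFlim : Tendsto (fun l => ∫ x, F l x ∂μ) atTop (𝓝 0) := by
    rw [← integral_zero X ℝ (μ := μ)]
    refine tendsto_integral_of_dominated_convergence (fun x => ‖f x‖)
      (fun l => (hFm l).aestronglyMeasurable) hf.norm
      (fun l => Eventually.of_forall fun x => ?_) (Eventually.of_forall fun x => ?_)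
    · rw [Real.norm_of_nonneg (hF0 l x)]
      exact Set.indicator_le_self' (fun _ _ => norm_nonneg _) x
    · obtain ⟨l₀, hl₀⟩ := exists_nat_ge ‖f x‖
      refine tendsto_const_nhds.congr' ?_
      filter_upwards [eventually_ge_atTop l₀] with l hl
      refine (Set.indicator_of_notMem (s := {x | (l : ℝ) < ‖f x‖}) ?_ _).symm
      exact not_lt.2 (hl₀.trans (by exact_mod_cast hl))
  filter_upwards [ae_tendsto_cesaroMean_comp_iterate hT hfm hf,
    ae_all_iff.2 fun l => ae_tendsto_cesaroMean_comp_iterate_real hT (hFm l) (hFi l)] with x h1 h2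
  refine tendsto_of_forall_approx fun ε hε =>
    ⟨fun N => c * cesaroMean (fun n => f (T^[n] x)) N, h1.const_mul c, ?_⟩
  have hM : 0 ≤ M := (norm_nonneg _).trans (hWM 0)
  obtain ⟨l, hl⟩ : ∃ l, (M + ‖c‖) * ∫ x, F l x ∂μ < ε := by
    have := hFlim.const_mul (M + ‖c‖)
    rw [mul_zero] at this
    exact (this.eventually (gt_mem_nhds hε)).exists
  have hlim : Tendsto (fun N => l * boxMean (fun n => ‖W n - c‖) N +
      (M + ‖c‖) * cesaroMean (fun n => F l (T^[n] x)) N) atTop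
      (𝓝 (l * 0 + (M + ‖c‖) * ∫ x, F l x ∂μ)) :=
    (hWc.const_mul _).add ((h2 l).const_mul _)
  rw [mul_zero, zero_add] at hlim
  filter_upwards [hlim.eventually (gt_mem_nhds hl), eventually_ne_atTop 0] with N hN hN0
  have e : boxMean (fun n => W n * f (T^[n a] x)) N - c * cesaroMean (fun n => f (T^[n] x)) N
      = boxMean (fun n => (W n - c) * f (T^[n a] x)) N := by
    rw [← boxMean_coord a _ hN0, ← boxMean_mul_left, sub_eq_iff_eq_add, ← boxMean_add]
    congr 1
    ext n
    ring
  rw [e]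
  refine ((norm_boxMean_le _ N).trans ?_).trans hN.le
  rw [← boxMean_coord a _ hN0, ← boxMean_mul_left, ← boxMean_mul_left, ← boxMean_add]
  refine boxMean_mono (fun n => ?_) N
  rw [norm_mul]
  have h3 : ‖W n - c‖ ≤ M + ‖c‖ := (norm_sub_le _ _).trans (by gcongr; exact hWM n)
  calc ‖W n - c‖ * ‖f (T^[n a] x)‖ ≤ ‖W n - c‖ * (l + F l (T^[n a] x)) := by
        gcongr
        exact hFle _ _
    _ = l * ‖W n - c‖ + ‖W n - c‖ * F l (T^[n a] x) := by ring
    _ ≤ _ := by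
        gcongr
        exact hF0 _ _

/-- Multiplying bounded weights by a null sequence in one coordinate gives null weights. -/
lemma tendsto_boxMean_norm_mul_coord {k : ℕ} (a : Fin k) {W : (Fin k → ℕ) → ℂ} {M : ℝ}
    (hWM : ∀ n, ‖W n‖ ≤ M) {c : ℕ → ℂ} (hc : CesaroNull fun n => ‖c n‖) :
    Tendsto (boxMean fun n => ‖W n * c (n a)‖) atTop (𝓝 0) := by
  have h1 := Tendsto.const_mul M hc
  rw [mul_zero] at h1
  refine squeeze_zero' (Eventually.of_forall fun N => boxMean_nonneg (fun n => norm_nonneg _) N)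
    ?_ h1
  filter_upwards [eventually_ne_atTop 0] with N hN
  rw [← boxMean_coord a _ hN, ← boxMean_mul_left]
  refine boxMean_mono (fun n => ?_) N
  rw [norm_mul]
  gcongr
  exact hWM n

/-- Entangled averages with bounded weights `W` that tend to `c` in mean. The weights make the
induction on the number of operators possible: the coefficients of the decomposition of
`A 0 * S 0 ^ n` are absorbed in them. -/
theorem ae_tendsto_boxMean_entangledProduct (hp : p ≠ ∞) (d : ℕ) {k : ℕ}
    (α : Fin (d + 1) → Fin k) (S : Fin (d + 1) → Lp ℂ p μ →L[ℂ] Lp ℂ p μ)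
    (A : Fin d → Lp ℂ p μ →L[ℂ] Lp ℂ p μ)
    (hS : ∀ i, ∃ (T : X → X) (hT : IsWeaklyMixing T μ), S i = koopman p hT.measurePreserving)
    (hA1 : ∀ j : Fin d, TwistedCompact (A j) (S j.castSucc))
    (hA2 : JointlyLinftyBounded A fun j : Fin d => S j.castSucc)
    (f : Lp ℂ p μ) (W : (Fin k → ℕ) → ℂ) (c : ℂ) (M : ℝ) (hWM : ∀ n, ‖W n‖ ≤ M)
    (hWc : Tendsto (boxMean fun n => ‖W n - c‖) atTop (𝓝 0)) :
    ∀ᵐ x ∂μ, Tendsto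
      (boxMean fun n => W n * (entangledProduct d S A (fun i => n (α i)) f : X → ℂ) x) atTop
      (𝓝 (c * ((∫ y, f y ∂μ) * ∏ i : Fin d, ∫ y, A i (Lp.const p μ (1 : ℂ)) y ∂μ))) := by
  induction d generalizing f W c M with
  | zero =>
    obtain ⟨T, hT, hST⟩ := hS 0
    have h1 : ∀ᵐ x ∂μ, ∀ n, ((S 0 ^ n) f : X → ℂ) x = f (T^[n] x) := by
      rw [ae_all_iff, hST]
      exact fun n => coeFn_koopman_pow hT.measurePreserving n f
    filter_upwards [h1, ae_tendsto_boxMean_mul_comp_iterate hT.ergodic (α 0)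
      (Lp.stronglyMeasurable f).measurable (integrable_coeFn_Lp f) hWM hWc] with x e1 e2
    simpa only [entangledProduct, e1, Finset.univ_eq_empty, Finset.prod_empty, mul_one] using e2
  | succ d ih =>
    set E : (Fin k → ℕ) → Lp ℂ p μ →L[ℂ] Lp ℂ p μ := fun n =>
      entangledProduct d (fun i => S i.succ) (fun i => A i.succ) (fun i => n (α i.succ)) with hE
    set P : ℂ := ∏ i : Fin d, ∫ y, A i.succ (Lp.const p μ (1 : ℂ)) y ∂μ with hP
    obtain ⟨C, hC, hCb⟩ := hA2.exists_forall_mem_linftyBall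
    have hA2' : JointlyLinftyBounded (fun j : Fin d => A j.succ) fun j => S j.castSucc.succ := by
      obtain ⟨C, hC, h⟩ := hA2
      exact ⟨C, hC, fun n j => h n j.succ⟩
    have IH := fun f W c M => ih (fun i => α i.succ) (fun i => S i.succ) (fun i => A i.succ)
      (fun i => hS i.succ) (fun j => hA1 j.succ) hA2' f W c M
    have hS' : ∀ i : Fin (d + 1), ∃ (T : X → X) (hT : MeasurePreserving T μ μ),
        S i.succ = koopman p hT := fun i => by
      obtain ⟨T, hT, h⟩ := hS i.succ
      exact ⟨T, hT.measurePreserving, h⟩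
    have hEball : ∀ n {ε : ℝ} {g : Lp ℂ p μ}, 0 ≤ ε → g ∈ linftyBall μ p ε →
        E n g ∈ linftyBall μ p (C ^ d * ε) := fun n ε g hε hg =>
      entangledProduct_mem_linftyBall hC d (S := fun i => S i.succ) (A := fun i => A i.succ)
        hS' (fun n j => hCb n j.succ) _ hε hg
    have hM : 0 ≤ M := (norm_nonneg _).trans (hWM 0)
    obtain ⟨T, hT, hST⟩ := hS 0
    have hA0 : TwistedCompact (A 0) (koopman p hT.measurePreserving) := hST ▸ hA1 0
    set I : ℂ := ∫ y, f y ∂μ with hI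
    set one : Lp ℂ p μ := Lp.const p μ (1 : ℂ) with hone
    have step : ∀ l : ℕ, ∀ᵐ x ∂μ, ∃ y : ℕ → ℂ,
        Tendsto y atTop (𝓝 (c * (I * ((∫ y, A 0 one y ∂μ) * P)))) ∧ ∀ᶠ N in atTop,
          ‖boxMean (fun n => W n * (E n (A 0 ((S 0 ^ n (α 0)) f)) : X → ℂ) x) N - y N‖
            ≤ 1 / (l + 1 : ℝ) := by
      intro l
      -- The remainder enters the average with the factor `M * C ^ d`.
      set ε : ℝ := 1 / (l + 1 : ℝ) / (M * C ^ d + 1) with hε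
      have hε0 : 0 < ε := by positivity
      obtain ⟨m, g, b, r, hdec, hr, hbM, hb0⟩ := hA0.exists_decomposition hp hT f hε0
      have hpt : ∀ n : Fin k → ℕ, ∀ᵐ x ∂μ, (E n (A 0 ((S 0 ^ n (α 0)) f)) : X → ℂ) x
          = I * (E n (A 0 one) : X → ℂ) x + ∑ i, b i (n (α 0)) * (E n (g i) : X → ℂ) x
            + (E n (r (n (α 0))) : X → ℂ) x := by
        intro n
        have e : E n (A 0 ((S 0 ^ n (α 0)) f)) = I • E n (A 0 one)
            + ∑ i, b i (n (α 0)) • E n (g i) + E n (r (n (α 0))) := by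
          rw [hST, hdec, map_add, map_add, map_smul, map_sum]
          simp only [map_smul]
          rfl
        rw [e]
        filter_upwards [Lp.coeFn_add (I • E n (A 0 one) + ∑ i, b i (n (α 0)) • E n (g i))
            (E n (r (n (α 0)))),
          Lp.coeFn_add (I • E n (A 0 one)) (∑ i, b i (n (α 0)) • E n (g i)),
          Lp.coeFn_smul I (E n (A 0 one)),
          Lp.coeFn_finsetSum Finset.univ fun i => b i (n (α 0)) • E n (g i),
          ae_all_iff.2 fun i => Lp.coeFn_smul (b i (n (α 0))) (E n (g i))]
          with x e1 e2 e3 e4 e5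
        rw [e1, Pi.add_apply, e2, Pi.add_apply, e3, e4, Finset.sum_apply]
        simp only [e5, Pi.smul_apply, smul_eq_mul]
      have hrn : ∀ᵐ x ∂μ, ∀ n, ‖(E n (r (n (α 0))) : X → ℂ) x‖ ≤ C ^ d * ε :=
        ae_all_iff.2 fun n => hEball n hε0.le (hr _)
      have hmain := IH (A 0 one) W c M hWM hWc
      have hnull : ∀ i, ∀ᵐ x ∂μ, Tendsto (boxMean fun n =>
          W n * b i (n (α 0)) * (E n (g i) : X → ℂ) x) atTop (𝓝 0) := by
        intro i
        obtain ⟨M', hM'⟩ := hbM i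
        have := IH (g i) (fun n => W n * b i (n (α 0))) 0 (M * M')
          (fun n => by rw [norm_mul]; exact mul_le_mul (hWM n) (hM' _) (norm_nonneg _) hM)
          (by simpa only [sub_zero] using tendsto_boxMean_norm_mul_coord (α 0) hWM (hb0 i))
        simpa only [zero_mul] using this
      filter_upwards [ae_all_iff.2 hpt, hrn, hmain, ae_all_iff.2 hnull] with x e1 e2 e3 e4
      refine ⟨fun N => I * boxMean (fun n => W n * (E n (A 0 one) : X → ℂ) x) N
        + ∑ i, boxMean (fun n => W n * b i (n (α 0)) * (E n (g i) : X → ℂ) x) N, ?_, ?_⟩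
      · have h1 := (e3.const_mul I).add (tendsto_finsetSum Finset.univ fun i _ => e4 i)
        rw [Finset.sum_const_zero, add_zero, mul_left_comm] at h1
        exact h1
      · filter_upwards [eventually_ne_atTop 0] with N hN
        have e5 : (fun n => W n * (E n (A 0 ((S 0 ^ n (α 0)) f)) : X → ℂ) x) = fun n =>
            (I * (W n * (E n (A 0 one) : X → ℂ) x)
              + ∑ i, W n * b i (n (α 0)) * (E n (g i) : X → ℂ) x)
            + W n * (E n (r (n (α 0))) : X → ℂ) x := by
          ext n
          rw [e1 n, mul_add, mul_add, Finset.mul_sum]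
          simp only [mul_assoc, mul_left_comm I]
        rw [e5, boxMean_add, boxMean_add, boxMean_mul_left, boxMean_sum, add_sub_cancel_left]
        refine (norm_boxMean_le _ N).trans ?_
        have h2 : boxMean (fun _ : Fin k → ℕ => M * (C ^ d * ε)) N = M * (C ^ d * ε) :=
          boxMean_const _ hN
        refine ((boxMean_mono (fun n => ?_) N).trans h2.le).trans ?_
        · rw [norm_mul]
          exact mul_le_mul (hWM n) (e2 n) (norm_nonneg _) hM
        · calc M * (C ^ d * ε) ≤ (M * C ^ d + 1) * ε := by linarith
            _ = 1 / (l + 1 : ℝ) := by rw [hε]; field_simp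
    filter_upwards [ae_all_iff.2 step] with x hx
    rw [Fin.prod_univ_succ]
    -- The averages at `x` are those of `step`, by the recursion for the entangled product.
    refine tendsto_of_forall_approx fun ε hε => ?_
    obtain ⟨l, hl⟩ := exists_nat_one_div_lt hε
    obtain ⟨y, hy, hyN⟩ := hx l
    exact ⟨y, hy, hyN.mono fun N hN => hN.trans hl.le⟩

end Entangled

theorem mainTheorem3 {X : Type*} [TopologicalSpace X] [CompactSpace X]
    [TopologicalSpace.MetrizableSpace X] [MeasurableSpace X] [BorelSpace X]
    (μ : Measure X) [IsProbabilityMeasure μ]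
    (p : ℝ≥0∞) [Fact (1 ≤ p)] (hp : p ≠ ∞)
    (d k : ℕ) (hd : 0 < d) (α : Fin (d + 1) → Fin k)
    (T : Fin (d + 1) → X → X) (hT : ∀ i, IsWeaklyMixing (T i) μ)
    (A : Fin d → Lp ℂ p μ →L[ℂ] Lp ℂ p μ)
    (hA1 : ∀ j : Fin d,
      TwistedCompact (A j) (koopman p (hT j.castSucc).measurePreserving))
    (hA2 : JointlyLinftyBounded A
      (fun j : Fin d => koopman p (hT j.castSucc).measurePreserving))
    (f : Lp ℂ p μ) :
    ∀ᵐ x ∂μ, Tendsto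
      (fun N : ℕ =>
        entangledAverage α (fun i => koopman p (hT i).measurePreserving) A f N x)
      atTop
      (𝓝 ((∫ y, f y ∂μ) * ∏ i : Fin d, ∫ y, A i (Lp.const p μ (1 : ℂ)) y ∂μ)) := by
  have key := ae_tendsto_boxMean_entangledProduct hp d α
    (fun i => koopman p (hT i).measurePreserving) A (fun i => ⟨T i, hT i, rfl⟩) hA1 hA2 f
    (fun _ => 1) 1 1 (fun _ => by simp) (by
      have : boxMean (fun _ : Fin k → ℕ => ‖(1 : ℂ) - 1‖) = fun _ => 0 := by
        ext N
        simp [boxMean]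
      rw [this]
      exact tendsto_const_nhds)
  simp only [one_mul] at key
  exact key
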